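/- Let $X\in\mathbb{R}^{N\times d}$ have rank $r$ and singular value decomposition $X=U\Sigma V^{T}$, where $U\in\mathbb{R}^{N\times r}$ and $V\in\mathbb{R}^{d\times r}$ have orthonormal columns and $\Sigma=\mathrm{diag}(\sigma_1,\dots,\sigma_r)$ with $\sigma_1\ge\dots\ge\sigma_r>0$; put $\sigma_j=0$ for $j>r$. Let $k\le r$, let $V_k\in\mathbb{R}^{d\times k}$ consist of the first $k$ columns of $V$, and let $S$ be a random subset of $[d]=\{1,\dots,d\}$ drawn from the projection determinantal point process (DPP) of marginal kernel $K=V_kV_k^{T}$, that is, $\mathbb{P}(T\subseteq S)=\det (K_{i,j})_{i,j\in T}$ for all $T\subseteq[d]$ (so that $|S|=k$ almost surely). Let $\|\cdot\|_2$ and $\|\cdot\|_{\mathrm{Fr}}$ be the spectral and Frobenius norms. For $\nu\in\{2,\mathrm{Fr}\}$, let $\Pi_kX$ be a best approximation of $X$ in the norm $\|\cdot\|_\nu$ among matrices of rank at most $k$, and, for $|S|=k$, let $\Pi_S^{\nu}X$ be a minimizer of $\|X-A\|_\nu$ over the matrices $A=X_{:,S}B$ with $B\in\mathbb{R}^{k\times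 d}$. Let $$p=\#\Big\{i\in[d]:\ \ell_i^k\ne0\Big\},\qquad \ell^k_i=\sum_{j=1}^k V_{i,j}^2,\qquad\qquad \beta=\sigma_{k+1}^2\Big(\frac1{d-k}\sum_{j=k+1}^{d}\sigma_j^2\Big)^{-1}$$ be the number of nonzero $k$-leverage scores and the flatness parameter (quotients with zero denominator are read as $0$; this only concerns $k=r$, where $X=\Pi_kX$). Then $$\mathbb{E}\,\|X-\Pi_S^{2}X\|_2^2\ \le\ \bigl(1+k(p-k)\bigr)\,\|X-\Pi_kX\|_2^2$$ and $$\mathbb{E}\,\|X-\Pi_S^{\mathrm{Fr}}X\|_{\mathrm{Fr}}^2\ \le\ \Big(1+\beta\,\frac{p-k}{d-k}\,k\Big)\,\|X-\Pi_kX\|_{\mathrm{Fr}}^2 .$$ -/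

import Mathlib

/-- `(U, σ, V)` is a (thin) singular value decomposition `X = U diag(σ) Vᵀ` of the `N × d` matrix
`X`: `U` and `V` have orthonormal columns, and `σ 0 ≥ σ 1 ≥ ... > 0`. The number `r` of columns of
`U` and `V` is then the rank of `X`. -/
structure IsSVD {N d r : ℕ} (X : Matrix (Fin N) (Fin d) ℝ) (U : Matrix (Fin N) (Fin r) ℝ)
    (σ : Fin r → ℝ) (V : Matrix (Fin d) (Fin r) ℝ) : Prop where
  left_orthonormal : U.transpose * U = 1
  right_orthonormal : V.transpose * V = 1
  pos : ∀ i, 0 < σ i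
  antitone : Antitone σ
  eq_mul : X = U * Matrix.diagonal σ * V.transpose

/-- The first `k` columns `V_k` of `V`. -/
def firstCols {d r : ℕ} (V : Matrix (Fin d) (Fin r) ℝ) (k : ℕ) (hk : k ≤ r) :
    Matrix (Fin d) (Fin k) ℝ :=
  V.submatrix id (Fin.castLE hk)

/-- The singular value of (zero-based) index `i`, read as `0` beyond the rank. -/
def singVal {r : ℕ} (σ : Fin r → ℝ) (i : ℕ) : ℝ :=
  if h : i < r then σ ⟨i, h⟩ else 0

/-- The flatness parameter
`β = σ_{k+1}² ((1 / (d - k)) ∑_{j ≥ k+1} σ_j²)⁻¹` (one-based indices). -/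
noncomputable def flatness {r : ℕ} (d k : ℕ) (σ : Fin r → ℝ) : ℝ :=
  singVal σ k ^ 2 * (1 / ((d : ℝ) - (k : ℝ)) * ∑ j ∈ Finset.Ico k d, singVal σ j ^ 2)⁻¹

/-- The `k`-leverage score of index `i`: the squared norm of the `i`-th row of `V_k`. -/
def leverageScore {d k : ℕ} (W : Matrix (Fin d) (Fin k) ℝ) (i : Fin d) : ℝ :=
  ∑ j, W i j ^ 2

/-- The number `p` of nonzero `k`-leverage scores. -/
noncomputable def sparsity {d k : ℕ} (W : Matrix (Fin d) (Fin k) ℝ) : ℕ :=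
  Set.ncard {i : Fin d | leverageScore W i ≠ 0}

open scoped Matrix.Norms.L2Operator in
/-- The spectral norm. -/
noncomputable def specNorm {m n : ℕ} (A : Matrix (Fin m) (Fin n) ℝ) : ℝ := ‖A‖

open scoped Matrix.Norms.Frobenius in
/-- The Frobenius norm. -/
noncomputable def frobNorm {m n : ℕ} (A : Matrix (Fin m) (Fin n) ℝ) : ℝ := ‖A‖

/-- The law `μ` of a random subset of `[d]` is the determinantal point process of marginal kernel
`K`: the probability that the random subset contains `S` is `det K_S`, for every `S`. -/
def IsDPP {d : ℕ} (K : Matrix (Fin d) (Fin d) ℝ) (μ : PMF (Finset (Fin d))) : Prop :=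
  ∀ S : Finset (Fin d), (∑ T with S ⊆ T, (μ T).toReal) =
    (K.submatrix (fun i : {i // i ∈ S} => (i : Fin d)) (fun i : {i // i ∈ S} => (i : Fin d))).det

/-- Expectation of `f` under the law `μ` of a random subset of `[d]`. -/
noncomputable def expectation {d : ℕ} (μ : PMF (Finset (Fin d))) (f : Finset (Fin d) → ℝ) : ℝ :=
  ∑ S, (μ S).toReal * f S

/-- `A` minimizes `ν (X - A)` over the matrices in `𝒜`. -/
def IsBestApprox {N d : ℕ} (ν : Matrix (Fin N) (Fin d) ℝ → ℝ) (X : Matrix (Fin N) (Fin d) ℝ)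
    (𝒜 : Set (Matrix (Fin N) (Fin d) ℝ)) (A : Matrix (Fin N) (Fin d) ℝ) : Prop :=
  A ∈ 𝒜 ∧ ∀ A' ∈ 𝒜, ν (X - A) ≤ ν (X - A')

/-- The `N × d` matrices of rank at most `k`. -/
def rankLE (N d k : ℕ) : Set (Matrix (Fin N) (Fin d) ℝ) :=
  {A | A.rank ≤ k}

/-- The submatrix `X_{:,S}` made of the columns of `X` indexed by `S`. -/
def colSubmatrix {N d : ℕ} (X : Matrix (Fin N) (Fin d) ℝ) (S : Finset (Fin d)) :
    Matrix (Fin N) {i // i ∈ S} ℝ :=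
  X.submatrix id (fun i => (i : Fin d))

/-- The matrices `X_{:,S} B` with `B` of rank at most `k`. -/
def colSpanRankLE {N d : ℕ} (X : Matrix (Fin N) (Fin d) ℝ) (S : Finset (Fin d)) (k : ℕ) :
    Set (Matrix (Fin N) (Fin d) ℝ) :=
  {A | ∃ B : Matrix {i // i ∈ S} (Fin d) ℝ, B.rank ≤ k ∧ A = colSubmatrix X S * B}

/-! Write `W` for `V_k`, `Y = X(1 - W Wᵀ)` for the singular tail, and `q(S) = det(W_S)²`. A
projection DPP charges only sets of size `k`, with mass `q(S)`. For `q(S) ≠ 0` let `E` be the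
inclusion of the coordinates in `S`, `B = (W_Sᵀ)⁻¹ Wᵀ`, and `P = E B`. Then `X P` lies in the span
of the selected columns, so its error bounds that of either best approximation.

From `Wᵀ P = Wᵀ` follows `X - X P = Y - Y P`. The rows of `Y P` are orthogonal to those of `Y`, and
`Y P = Y Q` with `Q = (1 - W Wᵀ) P`. Hence the squared error in either norm is at most that of the
tail `Y` plus `σ_{k+1}² t(S)`, where `t(S) = ‖Q‖_Fr² = ‖P‖_Fr² - k` (`IsSVD.exists_colSpan_error`).

Cramer's rule turns `q(S) t(S)` into the sum of `q(S - s + j)` over `s ∈ S`, `j ∉ S`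
(`exists_oblique_factor`). Summing over `S` and reversing each exchange, a set is reached at most `k
(p - k)` times, so `E t ≤ k (p - k)` (`sum_exchange_le`). The lower-bound half of Eckart–Young, in
both norms, replaces singular values by the errors of `Π_k X`. -/

open Matrix

/-! ### Spectral and Frobenius norms -/

section Norms

variable {m n l : ℕ}

lemma frobNorm_sq (A : Matrix (Fin m) (Fin n) ℝ) : frobNorm A ^ 2 = ∑ i, ∑ j, A i j ^ 2 := by
  unfold frobNorm
  rw [Matrix.frobenius_norm_def, ← Real.sqrt_eq_rpow, Real.sq_sqrt (by positivity)]
  simp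

lemma sum_sq_eq_trace {ι κ : Type*} [Fintype ι] [Fintype κ] (A : Matrix ι κ ℝ) :
    ∑ i, ∑ j, A i j ^ 2 = (A * Aᵀ).trace := by
  simp [Matrix.trace, Matrix.mul_apply, sq]

lemma frobNorm_sq_eq_trace (A : Matrix (Fin m) (Fin n) ℝ) : frobNorm A ^ 2 = (A * Aᵀ).trace := by
  rw [frobNorm_sq, sum_sq_eq_trace]

lemma trace_mul_transpose_nonneg {ι κ : Type*} [Fintype ι] [Fintype κ] (A : Matrix ι κ ℝ) :
    0 ≤ (A * Aᵀ).trace := by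
  rw [← sum_sq_eq_trace]; positivity

lemma frobNorm_nonneg (A : Matrix (Fin m) (Fin n) ℝ) : 0 ≤ frobNorm A := by
  open scoped Matrix.Norms.Frobenius in exact norm_nonneg A

lemma specNorm_nonneg (A : Matrix (Fin m) (Fin n) ℝ) : 0 ≤ specNorm A := by
  open scoped Matrix.Norms.L2Operator in exact norm_nonneg A

lemma specNorm_mul_le (A : Matrix (Fin m) (Fin n) ℝ) (B : Matrix (Fin n) (Fin l) ℝ) :
    specNorm (A * B) ≤ specNorm A * specNorm B := by
  open scoped Matrix.Norms.L2Operator in exact Matrix.l2_opNorm_mul A B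

lemma specNorm_add_le (A B : Matrix (Fin m) (Fin n) ℝ) :
    specNorm (A + B) ≤ specNorm A + specNorm B := by
  open scoped Matrix.Norms.L2Operator in exact norm_add_le A B

lemma specNorm_transpose (A : Matrix (Fin m) (Fin n) ℝ) : specNorm Aᵀ = specNorm A := by
  open scoped Matrix.Norms.L2Operator in
    simpa [specNorm, Matrix.conjTranspose_eq_transpose_of_trivial]
      using Matrix.l2_opNorm_conjTranspose A

lemma specNorm_transpose_mul_self (A : Matrix (Fin m) (Fin n) ℝ) :
    specNorm (Aᵀ * A) = specNorm A ^ 2 := by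
  open scoped Matrix.Norms.L2Operator in
    simpa [specNorm, Matrix.conjTranspose_eq_transpose_of_trivial, sq]
      using Matrix.l2_opNorm_conjTranspose_mul_self A

lemma specNorm_mul_transpose_self (A : Matrix (Fin m) (Fin n) ℝ) :
    specNorm (A * Aᵀ) = specNorm A ^ 2 := by
  simpa [specNorm_transpose] using specNorm_transpose_mul_self Aᵀ

lemma specNorm_diagonal_le (v : Fin n → ℝ) {c : ℝ} (hc : 0 ≤ c) (hv : ∀ i, |v i| ≤ c) :
    specNorm (diagonal v) ≤ c := by
  have h : specNorm (diagonal v) = ‖v‖ := by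
    open scoped Matrix.Norms.L2Operator in exact Matrix.l2_opNorm_diagonal v
  rw [h]
  exact (pi_norm_le_iff_of_nonneg hc).2 hv

lemma specNorm_le_one_of_transpose_mul_self (A : Matrix (Fin m) (Fin n) ℝ) (h : Aᵀ * A = 1) :
    specNorm A ≤ 1 := by
  have h1 : specNorm (1 : Matrix (Fin n) (Fin n) ℝ) ≤ 1 := by
    rw [← Matrix.diagonal_one]
    exact specNorm_diagonal_le _ zero_le_one (by simp)
  rw [← h, specNorm_transpose_mul_self] at h1
  nlinarith [specNorm_nonneg A]

lemma sum_mulVec_sq_le (A : Matrix (Fin m) (Fin n) ℝ) (x : Fin n → ℝ) :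
    ∑ i, (A *ᵥ x) i ^ 2 ≤ specNorm A ^ 2 * ∑ j, x j ^ 2 := by
  open scoped Matrix.Norms.L2Operator in
    have h := Matrix.l2_opNorm_mulVec A (WithLp.toLp 2 x)
    have h2 := pow_le_pow_left₀ (norm_nonneg _) h 2
    rw [mul_pow, EuclideanSpace.norm_sq_eq, EuclideanSpace.norm_sq_eq] at h2
    simp only [Real.norm_eq_abs, sq_abs] at h2
    exact h2

lemma specNorm_le_of_forall (A : Matrix (Fin m) (Fin n) ℝ) {c : ℝ} (hc : 0 ≤ c)
    (h : ∀ x : Fin n → ℝ, ∑ i, (A *ᵥ x) i ^ 2 ≤ c ^ 2 * ∑ j, x j ^ 2) : specNorm A ≤ c := by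
  open scoped Matrix.Norms.L2Operator in
    unfold specNorm
    rw [Matrix.l2_opNorm_def]
    refine ContinuousLinearMap.opNorm_le_bound _ hc fun x => ?_
    refine le_of_sq_le_sq ?_ (by positivity)
    rw [mul_pow, EuclideanSpace.norm_sq_eq, EuclideanSpace.norm_sq_eq]
    simpa using h x.ofLp

lemma specNorm_le_frobNorm (A : Matrix (Fin m) (Fin n) ℝ) : specNorm A ≤ frobNorm A := by
  refine specNorm_le_of_forall A (frobNorm_nonneg A) fun x => ?_
  rw [frobNorm_sq, Finset.sum_mul]
  exact Finset.sum_le_sum fun i _ =>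
    Finset.sum_mul_sq_le_sq_mul_sq Finset.univ (A i) x

lemma frobNorm_mul_sq_le (A : Matrix (Fin m) (Fin n) ℝ) (B : Matrix (Fin n) (Fin l) ℝ) :
    frobNorm (A * B) ^ 2 ≤ specNorm A ^ 2 * frobNorm B ^ 2 := by
  rw [frobNorm_sq, frobNorm_sq, Finset.sum_comm, Finset.sum_comm (f := fun i j => B i j ^ 2),
    Finset.mul_sum]
  refine Finset.sum_le_sum fun j _ => ?_
  simpa [Matrix.mulVec, dotProduct, Matrix.mul_apply] using sum_mulVec_sq_le A fun i => B i j

end Norms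

/-! ### Lower bounds for low rank approximation -/

section EckartYoung

variable {N d r k : ℕ}

lemma singVal_of_lt (σ : Fin r → ℝ) {i : ℕ} (h : i < r) : singVal σ i = σ ⟨i, h⟩ := by
  simp [singVal, h]

lemma singVal_of_ge (σ : Fin r → ℝ) {i : ℕ} (h : r ≤ i) : singVal σ i = 0 := by
  simp [singVal, h.not_gt]

lemma IsSVD.rank_le {X : Matrix (Fin N) (Fin d) ℝ} {U : Matrix (Fin N) (Fin r) ℝ}
    {σ : Fin r → ℝ} {V : Matrix (Fin d) (Fin r) ℝ} (h : IsSVD X U σ V) : r ≤ d := by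
  have h1 : (Vᵀ * V).rank = r := by rw [h.right_orthonormal]; simp
  rw [Matrix.rank_transpose_mul_self] at h1
  simpa [h1] using V.rank_le_card_height

lemma IsSVD.singVal_nonneg {X : Matrix (Fin N) (Fin d) ℝ} {U : Matrix (Fin N) (Fin r) ℝ}
    {σ : Fin r → ℝ} {V : Matrix (Fin d) (Fin r) ℝ} (h : IsSVD X U σ V) (i : ℕ) :
    0 ≤ singVal σ i := by
  unfold singVal
  split_ifs with hi
  · exact (h.pos _).le
  · exact le_rfl

/-- By dimension, the span of the first `k + 1` right singular vectors contains a nonzero vector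
killed by `A`; on it `X - A` acts as `X`, which stretches by at least `σ_{k+1}`. -/
lemma IsSVD.singVal_le_of_rank_le {X : Matrix (Fin N) (Fin d) ℝ} {U : Matrix (Fin N) (Fin r) ℝ}
    {σ : Fin r → ℝ} {V : Matrix (Fin d) (Fin r) ℝ} (h : IsSVD X U σ V)
    (A : Matrix (Fin N) (Fin d) ℝ) (hA : A.rank ≤ k) : singVal σ k ≤ specNorm (X - A) := by
  rcases le_or_gt r k with hrk | hkr
  · rw [singVal_of_ge σ hrk]; exact specNorm_nonneg _
  let e : Fin (k + 1) → Fin r := Fin.castLE hkr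
  have he : Function.Injective e := Fin.castLE_injective _
  let W : Matrix (Fin d) (Fin (k + 1)) ℝ := V.submatrix id e
  have hW : Vᵀ * W = (1 : Matrix (Fin r) (Fin r) ℝ).submatrix id e := by
    rw [← h.right_orthonormal]; rfl
  have hWW : Wᵀ * W = 1 := by
    have : Wᵀ * W = (Vᵀ * V).submatrix e e := rfl
    rw [this, h.right_orthonormal, Matrix.submatrix_one e he]
  -- `A * W` has `k + 1` columns and rank at most `k`, so its Gram matrix is singular.
  have hdet : ((A * W)ᵀ * (A * W)).det = 0 := by
    by_contra hne
    have h1 := Matrix.rank_of_isUnit _ ((Matrix.isUnit_iff_isUnit_det _).2 (Ne.isUnit hne))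
    rw [Matrix.rank_transpose_mul_self] at h1
    have h2 := Matrix.rank_mul_le_left A W
    simp at h1
    omega
  obtain ⟨x, hx0, hx⟩ := Matrix.exists_mulVec_eq_zero_iff.2 hdet
  have hAx : (A * W) *ᵥ x = 0 := by
    have h1 : ((A * W) *ᵥ x) ⬝ᵥ ((A * W) *ᵥ x) = 0 := by
      rw [Matrix.dotProduct_mulVec, Matrix.vecMul_mulVec, ← Matrix.dotProduct_mulVec, hx,
        dotProduct_zero]
    exact dotProduct_self_eq_zero.1 h1
  have hnorm : ∀ {a b : ℕ} (M : Matrix (Fin a) (Fin b) ℝ) (_ : Mᵀ * M = 1) (y : Fin b → ℝ),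
      ∑ i, (M *ᵥ y) i ^ 2 = ∑ i, y i ^ 2 := by
    intro a b M hM y
    have h1 : (M *ᵥ y) ⬝ᵥ (M *ᵥ y) = y ⬝ᵥ y := by
      rw [Matrix.dotProduct_mulVec, Matrix.vecMul_mulVec, hM, Matrix.vecMul_one]
    simpa [dotProduct, sq] using h1
  have hxpos : 0 < ∑ i, x i ^ 2 := by
    obtain ⟨i, hi⟩ := Function.ne_iff.1 hx0
    exact Finset.sum_pos' (fun _ _ => sq_nonneg _) ⟨i, Finset.mem_univ _, by
      have : x i ≠ 0 := hi
      positivity⟩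
  have hXx : (X - A) *ᵥ (W *ᵥ x) =
      U *ᵥ (diagonal σ *ᵥ ((1 : Matrix (Fin r) (Fin r) ℝ).submatrix id e *ᵥ x)) := by
    rw [Matrix.sub_mulVec, Matrix.mulVec_mulVec, Matrix.mulVec_mulVec, hAx, sub_zero, h.eq_mul,
      ← hW, Matrix.mulVec_mulVec, Matrix.mulVec_mulVec, Matrix.mul_assoc, Matrix.mul_assoc]
  have hEE : ((1 : Matrix (Fin r) (Fin r) ℝ).submatrix id e)ᵀ *
      (1 : Matrix (Fin r) (Fin r) ℝ).submatrix id e = 1 := by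
    have : ((1 : Matrix (Fin r) (Fin r) ℝ).submatrix id e)ᵀ *
        (1 : Matrix (Fin r) (Fin r) ℝ).submatrix id e =
        ((1 : Matrix (Fin r) (Fin r) ℝ)ᵀ * 1).submatrix e e := rfl
    rw [this, Matrix.transpose_one, Matrix.one_mul, Matrix.submatrix_one e he]
  have key := sum_mulVec_sq_le (X - A) (W *ᵥ x)
  rw [hXx, hnorm U h.left_orthonormal, hnorm W hWW] at key
  have hσ : singVal σ k ^ 2 * ∑ i, x i ^ 2 ≤
      ∑ i, (diagonal σ *ᵥ ((1 : Matrix (Fin r) (Fin r) ℝ).submatrix id e *ᵥ x)) i ^ 2 := by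
    rw [← hnorm _ hEE x, Finset.mul_sum]
    refine Finset.sum_le_sum fun i _ => ?_
    rw [Matrix.mulVec_diagonal, mul_pow]
    rcases lt_or_ge k (i : ℕ) with hi | hi
    · have : ((1 : Matrix (Fin r) (Fin r) ℝ).submatrix id e *ᵥ x) i = 0 := by
        simp only [Matrix.mulVec, dotProduct]
        refine Finset.sum_eq_zero fun j _ => ?_
        have hij : i ≠ e j := by
          intro hh
          have := congrArg Fin.val hh
          simp [e] at this
          omega
        rw [Matrix.submatrix_apply, id, Matrix.one_apply_ne hij, zero_mul]
      simp [this]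
    · have : singVal σ k ≤ σ i := by
        rw [singVal_of_lt σ hkr]; exact h.antitone hi
      have h0 := h.singVal_nonneg k
      gcongr
  have := le_of_mul_le_mul_right (hσ.trans key) hxpos
  exact le_of_sq_le_sq this (specNorm_nonneg _)

/-- The orthogonal projection onto the kernel of `A`. -/
lemma exists_kernel_projection (A : Matrix (Fin N) (Fin d) ℝ) :
    ∃ R : Matrix (Fin d) (Fin d) ℝ, Rᵀ = R ∧ R * R = R ∧ A * R = 0 ∧
      (1 - R).trace = A.rank := by
  have hH : (Aᵀ * A).IsHermitian := by
    rw [Matrix.IsHermitian, Matrix.conjTranspose_eq_transpose_of_trivial]; simp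
  set Q : Matrix (Fin d) (Fin d) ℝ := (hH.eigenvectorUnitary).1 with hQ
  have hQQ : Qᵀ * Q = 1 := by
    have := (Matrix.mem_unitaryGroup_iff' (A := Q)).1 hH.eigenvectorUnitary.2
    rwa [Matrix.star_eq_conjTranspose, Matrix.conjTranspose_eq_transpose_of_trivial] at this
  have hspec : Aᵀ * A = Q * diagonal hH.eigenvalues * Qᵀ := by
    have := hH.spectral_theorem
    rw [Unitary.conjStarAlgAut_apply, Matrix.star_eq_conjTranspose,
      Matrix.conjTranspose_eq_transpose_of_trivial] at this
    exact this
  -- The indicator of the zero eigenvalues of `AᵀA`, whose kernel is that of `A`.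
  let v : Fin d → ℝ := fun i => if hH.eigenvalues i = 0 then 1 else 0
  have hmid : ∀ B C : Matrix (Fin d) (Fin d) ℝ, Q * B * Qᵀ * (Q * C * Qᵀ) = Q * (B * C) * Qᵀ := by
    intro B C
    calc _ = Q * B * (Qᵀ * Q) * C * Qᵀ := by simp only [Matrix.mul_assoc]
      _ = _ := by rw [hQQ]; simp only [Matrix.mul_assoc, Matrix.one_mul]
  refine ⟨Q * diagonal v * Qᵀ, ?_, ?_, ?_, ?_⟩
  · simp [Matrix.mul_assoc]
  · rw [hmid, Matrix.diagonal_mul_diagonal]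
    congr 3
    ext i; simp [v]
  · have h0 : Aᵀ * A * (Q * diagonal v * Qᵀ) = 0 := by
      rw [hspec, hmid, Matrix.diagonal_mul_diagonal]
      have : (fun i => hH.eigenvalues i * v i) = 0 := by
        ext i; simp [v]
      rw [this]; simp
    rw [← Matrix.conjTranspose_eq_transpose_of_trivial A] at h0
    exact (Matrix.conjTranspose_mul_self_mul_eq_zero A _).1 h0
  · rw [← Matrix.rank_transpose_mul_self, hH.rank_eq_card_non_zero_eigs, Matrix.trace_sub,
      Matrix.trace_mul_comm, ← Matrix.mul_assoc, hQQ, Matrix.one_mul, Matrix.trace_one,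
      Matrix.trace_diagonal, Fintype.card_subtype]
    have : (Fintype.card (Fin d) : ℝ) = ∑ i : Fin d, (1 : ℝ) := by simp
    rw [this, ← Finset.sum_sub_distrib, Finset.card_filter]
    push_cast
    refine Finset.sum_congr rfl fun i _ => ?_
    by_cases hi : hH.eigenvalues i = 0 <;> simp [v, hi]

/-- The difference of the two sides is `‖M (1 - R)‖_Fr²`. -/
lemma trace_projection_le {ι κ : Type*} [Fintype ι] [Fintype κ] [DecidableEq κ]
    (M : Matrix ι κ ℝ) (R : Matrix κ κ ℝ) (hT : Rᵀ = R) (hR : R * R = R) :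
    (M * R * Mᵀ).trace ≤ (M * Mᵀ).trace := by
  have h := trace_mul_transpose_nonneg (M * (1 - R))
  have h1 : M * (1 - R) * (M * (1 - R))ᵀ = M * Mᵀ - M * R * Mᵀ := by
    rw [Matrix.transpose_mul, Matrix.transpose_sub, hT, Matrix.transpose_one]
    have h2 : (1 - R) * (1 - R) = 1 - R := (show IsIdempotentElem R from hR).one_sub
    calc _ = M * ((1 - R) * (1 - R)) * Mᵀ := by simp only [Matrix.mul_assoc]
      _ = _ := by rw [h2, Matrix.mul_sub, Matrix.sub_mul, Matrix.mul_one]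
  rw [h1, Matrix.trace_sub] at h
  linarith

/-- Restricting to the kernel of `A` can only lower the error and leaves `∑ σ_j² w_j`, with `w_j`
the squared length of the projection of the `j`-th right singular vector to that kernel. Since `0 ≤
w_j ≤ 1` and the deficits `1 - w_j` sum to at most `k`, the sum is least when the deficits sit on
the `k` largest `σ_j`. -/
lemma IsSVD.sum_sq_le_of_rank_le {X : Matrix (Fin N) (Fin d) ℝ} {U : Matrix (Fin N) (Fin r) ℝ}
    {σ : Fin r → ℝ} {V : Matrix (Fin d) (Fin r) ℝ} (h : IsSVD X U σ V) (hk : k ≤ r)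
    (A : Matrix (Fin N) (Fin d) ℝ) (hA : A.rank ≤ k) :
    ∑ j : Fin r, (if (j : ℕ) < k then 0 else σ j ^ 2) ≤ frobNorm (X - A) ^ 2 := by
  obtain ⟨R, hT, hR, hAR, htr⟩ := exists_kernel_projection A
  let w : Fin r → ℝ := fun j => (Vᵀ * R * V) j j
  have hsand : ∀ (P : Matrix (Fin d) (Fin d) ℝ) (_ : Pᵀ = P) (_ : P * P = P) (j : Fin r),
      0 ≤ (Vᵀ * P * V) j j := by
    intro P hPT hP j
    have : Vᵀ * P * V = (P * V)ᵀ * (P * V) := by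
      rw [Matrix.transpose_mul, hPT]
      calc _ = Vᵀ * (P * P) * V := by rw [hP]
        _ = _ := by simp only [Matrix.mul_assoc]
    rw [this, Matrix.mul_apply]
    exact Finset.sum_nonneg fun i _ => by
      rw [Matrix.transpose_apply]; exact mul_self_nonneg _
  have hT' : (1 - R)ᵀ = 1 - R := by rw [Matrix.transpose_sub, hT, Matrix.transpose_one]
  have hR' : (1 - R) * (1 - R) = 1 - R := (show IsIdempotentElem R from hR).one_sub
  have hw0 : ∀ j, 0 ≤ w j := hsand R hT hR
  have hsub : Vᵀ * (1 - R) * V = 1 - Vᵀ * R * V := by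
    rw [Matrix.mul_sub, Matrix.sub_mul, Matrix.mul_one, h.right_orthonormal]
  have hw1 : ∀ j, w j ≤ 1 := by
    intro j
    have := hsand _ hT' hR' j
    rw [hsub, Matrix.sub_apply, Matrix.one_apply_eq] at this
    simp only [w]; linarith
  have hsum : ∑ j, (1 - w j) ≤ k := by
    have h1 : ∑ j, (1 - w j) = (Vᵀ * (1 - R) * V).trace := by
      rw [hsub, Matrix.trace]; simp [w]
    have h2 : (Vᵀ * (1 - R) * V).trace = ((1 - R) * (V * Vᵀ) * (1 - R)ᵀ).trace := by
      rw [Matrix.trace_mul_comm, hT', Matrix.trace_mul_comm (_ * _) (1 - R), ← Matrix.mul_assoc,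
        ← Matrix.mul_assoc, ← Matrix.mul_assoc, hR', Matrix.trace_mul_comm _ (1 - R),
        Matrix.mul_assoc]
    have h3 := trace_projection_le (1 - R) (V * Vᵀ) (by simp) (by
      calc _ = V * (Vᵀ * V) * Vᵀ := by simp only [Matrix.mul_assoc]
        _ = _ := by rw [h.right_orthonormal, Matrix.mul_one])
    rw [h1, h2]
    refine h3.trans ?_
    rw [hT', hR', htr]
    exact_mod_cast hA
  have hlow : ∑ j, σ j ^ 2 * w j ≤ frobNorm (X - A) ^ 2 := by
    have h1 := trace_projection_le (X - A) R hT hR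
    rw [← frobNorm_sq_eq_trace] at h1
    have h2 : (X - A) * R * (X - A)ᵀ = X * R * Xᵀ := by
      have hRA : R * Aᵀ = 0 := by rw [← hT, ← Matrix.transpose_mul, hAR, Matrix.transpose_zero]
      rw [Matrix.sub_mul, hAR, sub_zero, Matrix.transpose_sub, Matrix.mul_sub,
        Matrix.mul_assoc X R Aᵀ, hRA, Matrix.mul_zero, sub_zero]
    have h3 : (X * R * Xᵀ).trace = ∑ j, σ j ^ 2 * w j := by
      have h4 : X * R * Xᵀ = U * (diagonal σ * (Vᵀ * R * V) * diagonal σ * Uᵀ) := by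
        rw [h.eq_mul]; simp [Matrix.mul_assoc]
      rw [h4, Matrix.trace_mul_comm, Matrix.mul_assoc, h.left_orthonormal, Matrix.mul_one,
        Matrix.trace]
      refine Finset.sum_congr rfl fun j _ => ?_
      rw [Matrix.diag_apply, Matrix.mul_diagonal, Matrix.diagonal_mul]
      simp only [w]; ring
    rw [h2, h3] at h1
    exact h1
  refine le_trans ?_ hlow
  have hcard : ∑ j : Fin r, (if (j : ℕ) < k then (1 : ℝ) else 0) = k := by
    rw [Finset.sum_ite, Finset.sum_const_zero, add_zero, Finset.sum_const, nsmul_eq_mul, mul_one]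
    congr 1
    rw [Fin.card_filter_val_lt]; omega
  have hs := h.singVal_nonneg k
  -- Termwise form of this linear program, with multiplier `σ_{k+1}²` for the constraint on the
  -- deficits.
  have hterm : ∀ j : Fin r, (if (j : ℕ) < k then 0 else σ j ^ 2) +
      singVal σ k ^ 2 * ((if (j : ℕ) < k then (1 : ℝ) else 0) - (1 - w j)) ≤ σ j ^ 2 * w j := by
    intro j
    split_ifs with hj
    · have : singVal σ k ≤ σ j := by
        rcases hk.eq_or_lt with rfl | hkr
        · rw [singVal_of_ge σ le_rfl]; exact (h.pos j).le
        · rw [singVal_of_lt σ hkr]; exact h.antitone hj.le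
      have h2 : singVal σ k ^ 2 ≤ σ j ^ 2 := pow_le_pow_left₀ hs this 2
      nlinarith [hw0 j]
    · have hkr : k < r := (not_lt.1 hj).trans_lt j.2
      have : σ j ≤ singVal σ k := by
        rw [singVal_of_lt σ hkr]; exact h.antitone (not_lt.1 hj)
      have h2 : σ j ^ 2 ≤ singVal σ k ^ 2 := pow_le_pow_left₀ (h.pos j).le this 2
      nlinarith [hw1 j]
  have := Finset.sum_le_sum fun j (_ : j ∈ Finset.univ) => hterm j
  rw [Finset.sum_add_distrib, ← Finset.mul_sum, Finset.sum_sub_distrib, hcard] at this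
  nlinarith [sq_nonneg (singVal σ k)]

end EckartYoung

/-! ### Projection determinantal point processes -/

section DPP

variable {d k : ℕ}

/-- The principal minor of `W Wᵀ` indexed by `S`. -/
noncomputable def gramMinor (W : Matrix (Fin d) (Fin k) ℝ) (S : Finset (Fin d)) : ℝ :=
  ((W * Wᵀ).submatrix (fun i : {i // i ∈ S} => (i : Fin d))
    (fun i : {i // i ∈ S} => (i : Fin d))).det

lemma gramMinor_eq_zero_of_lt_card (W : Matrix (Fin d) (Fin k) ℝ) {S : Finset (Fin d)}
    (hS : k < S.card) : gramMinor W S = 0 := by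
  by_contra hne
  have h1 := Matrix.rank_of_isUnit _ ((Matrix.isUnit_iff_isUnit_det _).2 (Ne.isUnit hne))
  have h2 : (W * Wᵀ).submatrix (fun i : {i // i ∈ S} => (i : Fin d))
      (fun i : {i // i ∈ S} => (i : Fin d)) =
      W.submatrix (fun i : {i // i ∈ S} => (i : Fin d)) id *
        Wᵀ.submatrix id (fun i : {i // i ∈ S} => (i : Fin d)) := rfl
  rw [h2] at h1
  have h3 := (Matrix.rank_mul_le_left (W.submatrix (fun i : {i // i ∈ S} => (i : Fin d)) id)
    (Wᵀ.submatrix id (fun i : {i // i ∈ S} => (i : Fin d)))).trans (Matrix.rank_le_card_width _)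
  simp at h1 h3
  omega

/-- Squaring makes the order of the rows irrelevant, so any injective enumeration will do; an
exchange then amounts to updating one value of `f`. -/
lemma gramMinor_image (W : Matrix (Fin d) (Fin k) ℝ) {f : Fin k → Fin d}
    (hf : Function.Injective f) :
    gramMinor W (Finset.univ.image f) = (W.submatrix f id).det ^ 2 := by
  let e : Fin k ≃ {i // i ∈ Finset.univ.image f} :=
    Equiv.ofBijective (fun a => ⟨f a, Finset.mem_image_of_mem f (Finset.mem_univ a)⟩)
      ⟨fun a b hab => hf (congrArg Subtype.val hab), fun ⟨i, hi⟩ => by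
        obtain ⟨a, -, rfl⟩ := Finset.mem_image.1 hi
        exact ⟨a, rfl⟩⟩
  have h : (W.submatrix f id).det ^ 2 = (W.submatrix f id * (W.submatrix f id)ᵀ).det := by
    rw [Matrix.det_mul, Matrix.det_transpose, sq]
  rw [h, gramMinor, ← Matrix.det_submatrix_equiv_self e]
  rfl

lemma gramMinor_nonneg (W : Matrix (Fin d) (Fin k) ℝ) {S : Finset (Fin d)} (hS : S.card = k) :
    0 ≤ gramMinor W S := by
  have h : Finset.univ.image (S.orderEmbOfFin hS) = S := by
    apply Finset.coe_injective; simp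
  rw [← h, gramMinor_image W (S.orderEmbOfFin hS).injective]
  positivity

/-- A zero leverage score means a zero row of `W`, hence a zero row in the minor. This is how `p`
enters the bound. -/
lemma leverageScore_ne_zero_of_gramMinor_ne_zero (W : Matrix (Fin d) (Fin k) ℝ)
    {S : Finset (Fin d)} (h : gramMinor W S ≠ 0) {i : Fin d} (hi : i ∈ S) :
    leverageScore W i ≠ 0 := by
  intro h0
  apply h
  have hz : ∀ j, W i j = 0 := fun j => by
    have := (Finset.sum_eq_zero_iff_of_nonneg fun j _ => sq_nonneg (W i j)).1 h0 j
      (Finset.mem_univ j)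
    simpa using this
  refine Matrix.det_eq_zero_of_row_eq_zero ⟨i, hi⟩ fun j => ?_
  simp [Matrix.mul_apply, hz]

variable {W : Matrix (Fin d) (Fin k) ℝ} {μ : PMF (Finset (Fin d))}

lemma sum_pmf_toReal {α : Type*} [Fintype α] (μ : PMF α) : ∑ S, (μ S).toReal = 1 := by
  rw [← ENNReal.toReal_sum fun S _ => μ.apply_ne_top S, ← tsum_fintype (L := .unconditional _), μ.tsum_coe]
  simp

lemma IsDPP.eq_zero_of_lt_card (hμ : IsDPP (W * Wᵀ) μ) {S : Finset (Fin d)} (hS : k < S.card) :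
    (μ S).toReal = 0 := by
  have h := hμ S
  change _ = gramMinor W S at h
  rw [gramMinor_eq_zero_of_lt_card W hS,
    Finset.sum_eq_zero_iff_of_nonneg fun _ _ => ENNReal.toReal_nonneg] at h
  exact h S (by simp)

/-- The cardinality never exceeds `k` with positive probability, while its mean is `tr(W Wᵀ) = k`;
so it equals `k` almost surely. -/
lemma IsDPP.eq_zero_of_card_ne (hW : Wᵀ * W = 1) (hμ : IsDPP (W * Wᵀ) μ) {S : Finset (Fin d)}
    (hS : S.card ≠ k) : (μ S).toReal = 0 := by
  have hE : ∑ T, (T.card : ℝ) * (μ T).toReal = k := by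
    calc ∑ T, (T.card : ℝ) * (μ T).toReal
        = ∑ T, ∑ i : Fin d, if i ∈ T then (μ T).toReal else 0 := by
          refine Finset.sum_congr rfl fun T _ => ?_
          rw [Finset.sum_ite_mem, Finset.univ_inter, Finset.sum_const, nsmul_eq_mul]
      _ = ∑ i : Fin d, ∑ T with {i} ⊆ T, (μ T).toReal := by
          rw [Finset.sum_comm]
          refine Finset.sum_congr rfl fun i _ => ?_
          rw [Finset.sum_filter]
          simp
      _ = (W * Wᵀ).trace := by
          refine Finset.sum_congr rfl fun i _ => ?_
          rw [hμ {i}]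
          have : Subsingleton {j // j ∈ ({i} : Finset (Fin d))} :=
            ⟨fun a b => Subtype.ext
              ((Finset.mem_singleton.1 a.2).trans (Finset.mem_singleton.1 b.2).symm)⟩
          rw [Matrix.det_eq_elem_of_subsingleton _ ⟨i, Finset.mem_singleton_self i⟩]
          rfl
      _ = k := by rw [Matrix.trace_mul_comm, hW]; simp
  have h0 : ∑ T, ((k : ℝ) - T.card) * (μ T).toReal = 0 := by
    simp only [sub_mul]
    rw [Finset.sum_sub_distrib, ← Finset.mul_sum, sum_pmf_toReal, hE]; ring
  have hnn : ∀ T ∈ Finset.univ, 0 ≤ ((k : ℝ) - T.card) * (μ T).toReal := by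
    intro T _
    rcases le_or_gt T.card k with h | h
    · exact mul_nonneg (sub_nonneg.2 (by exact_mod_cast h)) ENNReal.toReal_nonneg
    · rw [hμ.eq_zero_of_lt_card h, mul_zero]
  have := (Finset.sum_eq_zero_iff_of_nonneg hnn).1 h0 S (Finset.mem_univ S)
  refine (mul_eq_zero.1 this).resolve_left fun h => hS ?_
  have : (k : ℝ) = S.card := by linarith
  exact_mod_cast this.symm

/-- Strict supersets of `S` have more than `k` elements and carry no mass, so the inclusion
probability is the mass of `S` itself. -/
lemma IsDPP.eq_gramMinor (hμ : IsDPP (W * Wᵀ) μ) {S : Finset (Fin d)}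
    (hS : S.card = k) : (μ S).toReal = gramMinor W S := by
  have h := hμ S
  rw [Finset.sum_eq_single S] at h
  · exact h
  · intro T hT hne
    refine hμ.eq_zero_of_lt_card (hS ▸ Finset.card_lt_card ?_)
    exact (Finset.mem_filter.1 hT).2.ssubset_of_ne hne.symm
  · intro h; simp at h

/-! ### Oblique projections on selected coordinates -/

/-- If the minor indexed by `S` does not vanish, Cramer's rule solves `W_Sᵀ B = Wᵀ`. -/
lemma exists_oblique_factor (hW : Wᵀ * W = 1) {S : Finset (Fin d)} (hS : S.card = k)
    (hq : gramMinor W S ≠ 0) :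
    ∃ B : Matrix {i // i ∈ S} (Fin d) ℝ,
      (W.submatrix (fun i : {i // i ∈ S} => (i : Fin d)) id)ᵀ * B = Wᵀ ∧ B * (W * Wᵀ) = B ∧
      gramMinor W S * (∑ s, ∑ j, B s j ^ 2) =
        gramMinor W S * k + ∑ s ∈ S, ∑ j ∈ Sᶜ, gramMinor W (insert j (S.erase s)) := by
  let e : Fin k ≃ {i // i ∈ S} := (Finset.equivFinOfCardEq hS).symm
  let f : Fin k → Fin d := fun a => e a
  have hf : Function.Injective f := Subtype.val_injective.comp e.injective
  have him : Finset.univ.image f = S := by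
    ext i
    simp only [Finset.mem_image, Finset.mem_univ, true_and]
    constructor
    · rintro ⟨a, rfl⟩; exact (e a).2
    · intro hi; exact ⟨e.symm ⟨i, hi⟩, by simp [f]⟩
  set C : Matrix (Fin k) (Fin k) ℝ := W.submatrix f id with hC
  have hqC : gramMinor W S = C.det ^ 2 := by rw [← gramMinor_image W hf, him]
  have hdet : C.det ≠ 0 := by
    intro h; apply hq; rw [hqC, h]; simp
  have hunit : IsUnit (Cᵀ).det := by rw [Matrix.det_transpose]; exact Ne.isUnit hdet
  let B' : Matrix (Fin k) (Fin d) ℝ := (Cᵀ)⁻¹ * Wᵀ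
  have hB' : Cᵀ * B' = Wᵀ := Matrix.mul_nonsing_inv_cancel_left _ _ hunit
  -- Cramer's rule: the numerator is the determinant with row `a` replaced by row `j` of `W`.
  have hcr : ∀ a j, C.det * B' a j = (W.submatrix (Function.update f a j) id).det := by
    intro a j
    have h1 : W.submatrix (Function.update f a j) id = C.updateRow a (W j) := by
      ext b c
      by_cases hb : b = a
      · subst hb; simp
      · simp [hb, hC]
    rw [h1, ← Matrix.det_transpose (C.updateRow a (W j)), ← Matrix.updateCol_transpose,
      ← Matrix.cramer_apply, Matrix.cramer_eq_adjugate_mulVec]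
    have h2 : C.det • B' = (Cᵀ).adjugate * Wᵀ := by
      simp only [B', Matrix.inv_def, Matrix.det_transpose, Ring.inverse_eq_inv', Matrix.smul_mul]
      rw [smul_smul, mul_inv_cancel₀ hdet, one_smul]
    have h3 := congrFun (congrFun h2 a) j
    rw [Matrix.smul_apply, smul_eq_mul] at h3
    rw [h3]; rfl
  refine ⟨B'.submatrix e.symm id, ?_, ?_, ?_⟩
  · rw [← hB']
    ext i j
    simp only [Matrix.mul_apply, Matrix.transpose_apply, Matrix.submatrix_apply, id]
    rw [← e.sum_comp]
    simp [C, f]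
  · have h1 : B' * (W * Wᵀ) = B' := by
      calc B' * (W * Wᵀ) = (Cᵀ)⁻¹ * ((Wᵀ * W) * Wᵀ) := by simp only [B', Matrix.mul_assoc]
        _ = B' := by rw [hW, Matrix.one_mul]
    conv_rhs => rw [← h1]
    rfl
  · have h1 : ∑ s, ∑ j, B'.submatrix e.symm id s j ^ 2 = ∑ a, ∑ j, B' a j ^ 2 := by
      rw [← e.sum_comp]; simp
    have h2 : ∑ s ∈ S, ∑ j ∈ Sᶜ, gramMinor W (insert j (S.erase s)) =
        ∑ a, ∑ j ∈ Sᶜ, gramMinor W (insert j (S.erase (f a))) := by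
      rw [← Finset.sum_coe_sort S, ← e.sum_comp]
    have h3 : gramMinor W S * (k : ℝ) = ∑ a : Fin k, C.det ^ 2 := by
      rw [hqC]; simp [mul_comm]
    rw [h1, h2, h3, ← Finset.sum_add_distrib, Finset.mul_sum]
    refine Finset.sum_congr rfl fun a _ => ?_
    -- For `j ∈ S` the replacement repeats a row unless `j = f a`, leaving `det C²` for each `a` and
    -- hence the term in `k`. For `j ∉ S` it gives the minor of the exchanged set.
    rw [hqC, Finset.mul_sum, ← Finset.sum_add_sum_compl S]
    congr 1
    · rw [Finset.sum_eq_single (f a)]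
      · rw [← mul_pow, hcr, Function.update_eq_self]
      · intro j hj hne
        rw [← mul_pow, hcr]
        obtain ⟨b, -, rfl⟩ := Finset.mem_image.1 (him ▸ hj)
        have hba : b ≠ a := fun h => hne (by rw [h])
        rw [Matrix.det_zero_of_row_eq hba, zero_pow two_ne_zero]
        ext c; simp [hba]
      · intro h; exact absurd (e a).2 h
    · refine Finset.sum_congr rfl fun j hj => ?_
      have hj : j ∉ S := Finset.mem_compl.1 hj
      rw [← mul_pow, hcr, ← gramMinor_image]
      · congr 1
        ext i
        simp only [Finset.mem_image, Finset.mem_univ, true_and, Finset.mem_insert,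
          Finset.mem_erase]
        constructor
        · rintro ⟨b, rfl⟩
          by_cases hb : b = a
          · subst hb; simp
          · right; simp only [Function.update_of_ne hb]
            exact ⟨fun h => hb (hf h), (e b).2⟩
        · rintro (rfl | ⟨hne, hi⟩)
          · exact ⟨a, by simp⟩
          · obtain ⟨b, -, rfl⟩ := Finset.mem_image.1 (him ▸ hi)
            exact ⟨b, by rw [Function.update_of_ne]; rintro rfl; exact hne rfl⟩
      · have hnj : ∀ b, f b ≠ j := fun b h => hj (h ▸ (e b).2)
        intro b c hbc
        by_cases hb : b = a <;> by_cases hc : c = a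
        · rw [hb, hc]
        · subst hb; simp [hc] at hbc; exact absurd hbc.symm (hnj c)
        · subst hc; simp [hb] at hbc; exact absurd hbc (hnj b)
        · simp [hb, hc] at hbc; exact hf hbc

/-- Double counting: an exchange `(S, s, j)` is recovered from the new set `S'` and the pair `(j,
s)`. Here `j` is one of `k` elements of `S'`, and `s` lies outside `S'` but has nonzero leverage
because `q(S) ≠ 0`, which leaves `p - k` choices. -/
lemma sum_exchange_le (W : Matrix (Fin d) (Fin k) ℝ) :
    ∑ S with S.card = k ∧ gramMinor W S ≠ 0,
      ∑ s ∈ S, ∑ j ∈ Sᶜ, gramMinor W (insert j (S.erase s)) ≤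
    ∑ S with S.card = k ∧ gramMinor W S ≠ 0,
      gramMinor W S * ((k : ℝ) * ((sparsity W : ℝ) - k)) := by
  classical
  let L : Finset (Fin d) := Finset.univ.filter fun i => leverageScore W i ≠ 0
  have hL : sparsity W = L.card := by
    rw [sparsity, ← Set.ncard_coe_finset]; simp [L]
  let F : Finset (Finset (Fin d)) := Finset.univ.filter fun S => S.card = k ∧ gramMinor W S ≠ 0
  have hF : ∀ S ∈ F, S.card = k ∧ gramMinor W S ≠ 0 := fun S hS => (Finset.mem_filter.1 hS).2
  have hsub : ∀ S ∈ F, S ⊆ L := fun S hS i hi =>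
    Finset.mem_filter.2 ⟨Finset.mem_univ _,
      leverageScore_ne_zero_of_gramMinor_ne_zero W (hF S hS).2 hi⟩
  have hright : ∀ S ∈ F, gramMinor W S * ((k : ℝ) * ((sparsity W : ℝ) - k)) =
      ∑ s ∈ S, ∑ j ∈ L \ S, gramMinor W S := by
    intro S hS
    rw [Finset.sum_const, Finset.sum_const, Finset.card_sdiff_of_subset (hsub S hS), hL,
      (hF S hS).1, nsmul_eq_mul, nsmul_eq_mul,
      Nat.cast_sub ((hF S hS).1 ▸ Finset.card_le_card (hsub S hS))]
    ring
  change ∑ S ∈ F, _ ≤ ∑ S ∈ F, _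
  rw [Finset.sum_congr rfl hright]
  have hcard : ∀ {S : Finset (Fin d)} {s j : Fin d}, S.card = k → s ∈ S → j ∉ S →
      (insert j (S.erase s)).card = k := by
    intro S s j hS hs hj
    rw [Finset.card_insert_of_notMem (fun h => hj (Finset.mem_of_mem_erase h)),
      Finset.card_erase_add_one hs, hS]
  simp only [← Finset.sum_product', Finset.sum_sigma']
  let D : Finset ((_ : Finset (Fin d)) × (Fin d × Fin d)) := F.sigma fun S => S ×ˢ Sᶜ
  let D' : Finset ((_ : Finset (Fin d)) × (Fin d × Fin d)) := F.sigma fun S => S ×ˢ (L \ S)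
  change ∑ x ∈ D, gramMinor W (insert x.2.2 (x.1.erase x.2.1)) ≤ ∑ x ∈ D', gramMinor W x.1
  have hD : ∀ x ∈ D, x.1.card = k ∧ gramMinor W x.1 ≠ 0 ∧ x.2.1 ∈ x.1 ∧ x.2.2 ∉ x.1 := by
    intro x hx
    simp only [D, F, Finset.mem_sigma, Finset.mem_filter, Finset.mem_univ, true_and,
      Finset.mem_product, Finset.mem_compl] at hx
    exact ⟨hx.1.1, hx.1.2, hx.2.1, hx.2.2⟩
  -- Exchanges reaching a set of zero minor are dropped, so that the remaining targets stay in `F`.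
  rw [← Finset.sum_filter_ne_zero]
  let g : ((_ : Finset (Fin d)) × (Fin d × Fin d)) → ((_ : Finset (Fin d)) × (Fin d × Fin d)) :=
    fun x => ⟨insert x.2.2 (x.1.erase x.2.1), (x.2.2, x.2.1)⟩
  have hginj : Set.InjOn g (D.filter fun x =>
      gramMinor W (insert x.2.2 (x.1.erase x.2.1)) ≠ 0) := by
    have hinv : ∀ x ∈ D, g (g x) = x := by
      rintro ⟨S, s, j⟩ hx
      obtain ⟨-, -, hs, hj⟩ := hD _ hx
      simp only at hs hj
      have : insert s ((insert j (S.erase s)).erase j) = S := by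
        rw [Finset.erase_insert (fun h => hj (Finset.mem_of_mem_erase h)), Finset.insert_erase hs]
      simp only [g, this]
    intro x hx y hy hxy
    rw [← hinv x (Finset.mem_filter.1 hx).1, ← hinv y (Finset.mem_filter.1 hy).1, hxy]
  have hsum : ∑ x ∈ D with gramMinor W (insert x.2.2 (x.1.erase x.2.1)) ≠ 0,
      gramMinor W (insert x.2.2 (x.1.erase x.2.1)) =
      ∑ y ∈ (D.filter fun x => gramMinor W (insert x.2.2 (x.1.erase x.2.1)) ≠ 0).image g,
        gramMinor W y.1 := by
    rw [Finset.sum_image hginj]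
  rw [hsum]
  refine Finset.sum_le_sum_of_subset_of_nonneg ?_ ?_
  · intro y hy
    obtain ⟨⟨S, s, j⟩, hx, rfl⟩ := Finset.mem_image.1 hy
    obtain ⟨hx, hne⟩ := Finset.mem_filter.1 hx
    obtain ⟨hc, hq, hs, hj⟩ := hD _ hx
    simp only at hc hq hs hj hne
    have hsj : s ≠ j := fun h => hj (h ▸ hs)
    have hmem : S ∈ F := Finset.mem_filter.2 ⟨Finset.mem_univ _, hc, hq⟩
    simp only [D', g, Finset.mem_sigma, Finset.mem_product, Finset.mem_sdiff]
    refine ⟨Finset.mem_filter.2 ⟨Finset.mem_univ _, hcard hc hs hj, hne⟩,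
      Finset.mem_insert_self _ _, hsub S hmem hs, ?_⟩
    simp [hsj]
  · intro y hy _
    exact gramMinor_nonneg W (hF _ (Finset.mem_sigma.1 hy).1).1

end DPP

/-! ### The error of an oblique projection -/

section Oblique

variable {N d r k : ℕ}

/-- The rows of `Y * P` lie in the column space of `W`, to which the rows of `Y` are orthogonal; the
cross terms vanish. -/
lemma residual_mul_transpose {Y : Matrix (Fin N) (Fin d) ℝ} {W : Matrix (Fin d) (Fin k) ℝ}
    {P : Matrix (Fin d) (Fin d) ℝ} (hY : Y * W = 0) (hP : P * (W * Wᵀ) = P) :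
    (Y - Y * P) * (Y - Y * P)ᵀ = Y * Yᵀ + (Y * P) * (Y * P)ᵀ := by
  have h1 : Y * (Y * P)ᵀ = 0 := by
    rw [← hP]
    simp only [Matrix.transpose_mul, Matrix.transpose_transpose]
    simp only [← Matrix.mul_assoc]
    rw [hY]; simp
  have h2 : (Y * P) * Yᵀ = 0 := by
    have := congrArg Matrix.transpose h1
    simpa [Matrix.transpose_mul] using this
  rw [Matrix.transpose_sub, Matrix.mul_sub, Matrix.sub_mul, Matrix.sub_mul, h1, h2]
  simp

/-- Pythagoras: the component removed is `W Wᵀ P = W Wᵀ`, of squared Frobenius norm `k`. -/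
lemma frobNorm_sq_tangent {W : Matrix (Fin d) (Fin k) ℝ} {P : Matrix (Fin d) (Fin d) ℝ}
    (hW : Wᵀ * W = 1) (hP : Wᵀ * P = Wᵀ) :
    frobNorm ((1 - W * Wᵀ) * P) ^ 2 = frobNorm P ^ 2 - k := by
  have h1 : ((1 - W * Wᵀ) * P)ᵀ * ((1 - W * Wᵀ) * P) = Pᵀ * P - W * Wᵀ := by
    have h2 : (1 - W * Wᵀ) * P = P - W * Wᵀ := by
      rw [Matrix.sub_mul, Matrix.one_mul, Matrix.mul_assoc, hP]
    have h3 : Pᵀ * W = W := by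
      have := congrArg Matrix.transpose hP
      simpa [Matrix.transpose_mul] using this
    rw [h2, Matrix.transpose_sub, Matrix.mul_sub, Matrix.sub_mul, Matrix.sub_mul,
      Matrix.transpose_mul, Matrix.transpose_transpose, Matrix.mul_assoc W Wᵀ P, hP,
      ← Matrix.mul_assoc Pᵀ, h3, Matrix.mul_assoc W Wᵀ (W * Wᵀ), ← Matrix.mul_assoc Wᵀ W, hW,
      Matrix.one_mul, sub_self, sub_zero]
  rw [frobNorm_sq_eq_trace, Matrix.trace_mul_comm, h1, Matrix.trace_sub, frobNorm_sq_eq_trace,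
    Matrix.trace_mul_comm Pᵀ, Matrix.trace_mul_comm W, hW]
  simp

lemma firstCols_transpose_mul_self {V : Matrix (Fin d) (Fin r) ℝ} (hV : Vᵀ * V = 1) (hk : k ≤ r) :
    (firstCols V k hk)ᵀ * firstCols V k hk = 1 := by
  have : (firstCols V k hk)ᵀ * firstCols V k hk =
      (Vᵀ * V).submatrix (Fin.castLE hk) (Fin.castLE hk) := rfl
  rw [this, hV, Matrix.submatrix_one _ (Fin.castLE_injective hk)]

/-- The singular values beyond the index `k`. -/
def tailVal (k : ℕ) (σ : Fin r → ℝ) : Fin r → ℝ := fun j => if (j : ℕ) < k then 0 else σ j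

lemma IsSVD.sub_mul_firstCols {X : Matrix (Fin N) (Fin d) ℝ} {U : Matrix (Fin N) (Fin r) ℝ}
    {σ : Fin r → ℝ} {V : Matrix (Fin d) (Fin r) ℝ} (h : IsSVD X U σ V) (hk : k ≤ r) :
    X - X * (firstCols V k hk * (firstCols V k hk)ᵀ) = U * diagonal (tailVal k σ) * Vᵀ := by
  have h1 : Vᵀ * (firstCols V k hk * (firstCols V k hk)ᵀ) =
      diagonal (fun j : Fin r => if (j : ℕ) < k then (1 : ℝ) else 0) * Vᵀ := by
    have h2 : Vᵀ * firstCols V k hk =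
        (1 : Matrix (Fin r) (Fin r) ℝ).submatrix id (Fin.castLE hk) := by
      rw [← h.right_orthonormal]; rfl
    rw [← Matrix.mul_assoc, h2]
    ext j i
    rw [Matrix.diagonal_mul, Matrix.mul_apply]
    split_ifs with hj
    · rw [Finset.sum_eq_single ⟨j, hj⟩]
      · have : Fin.castLE hk ⟨j, hj⟩ = j := rfl
        rw [Matrix.submatrix_apply, id, this, Matrix.one_apply_eq, one_mul]
        simp [firstCols, this]
      · intro c _ hc
        have : j ≠ Fin.castLE hk c := fun hh => hc (by ext; simp [hh])
        rw [Matrix.submatrix_apply, id, Matrix.one_apply_ne this, zero_mul]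
      · simp
    · rw [zero_mul]
      refine Finset.sum_eq_zero fun c _ => ?_
      have : j ≠ Fin.castLE hk c := fun hh => hj (by rw [hh]; exact c.2)
      rw [Matrix.submatrix_apply, id, Matrix.one_apply_ne this, zero_mul]
  have h3 : diagonal (tailVal k σ) =
      diagonal σ - diagonal σ * diagonal (fun j : Fin r => if (j : ℕ) < k then (1 : ℝ) else 0) := by
    rw [Matrix.diagonal_mul_diagonal, Matrix.diagonal_sub]
    congr 1
    ext j
    simp only [tailVal]
    split_ifs <;> simp
  rw [h3, Matrix.mul_sub, Matrix.sub_mul, ← h.eq_mul]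
  congr 1
  conv_lhs => rw [h.eq_mul]
  rw [Matrix.mul_assoc, h1]
  simp only [Matrix.mul_assoc]

lemma IsSVD.specNorm_tail_le {X : Matrix (Fin N) (Fin d) ℝ} {U : Matrix (Fin N) (Fin r) ℝ}
    {σ : Fin r → ℝ} {V : Matrix (Fin d) (Fin r) ℝ} (h : IsSVD X U σ V) :
    specNorm (U * diagonal (tailVal k σ) * Vᵀ) ≤ singVal σ k := by
  have h0 := h.singVal_nonneg k
  have hd : specNorm (diagonal (tailVal k σ)) ≤ singVal σ k := by
    refine specNorm_diagonal_le _ h0 fun j => ?_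
    unfold tailVal
    split_ifs with hj
    · simpa using h0
    · have hkr : k < r := (not_lt.1 hj).trans_lt j.2
      rw [abs_of_pos (h.pos j), singVal_of_lt σ hkr]
      exact h.antitone (not_lt.1 hj)
  have hU := specNorm_le_one_of_transpose_mul_self U h.left_orthonormal
  have hV := specNorm_le_one_of_transpose_mul_self V h.right_orthonormal
  rw [← specNorm_transpose] at hV
  calc specNorm (U * diagonal (tailVal k σ) * Vᵀ)
      ≤ specNorm U * specNorm (diagonal (tailVal k σ)) * specNorm Vᵀ :=
        (specNorm_mul_le _ _).trans
          (mul_le_mul_of_nonneg_right (specNorm_mul_le _ _) (specNorm_nonneg _))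
    _ ≤ 1 * singVal σ k * 1 := by
        gcongr
        · exact specNorm_nonneg _
        · exact specNorm_nonneg _
    _ = singVal σ k := by ring

lemma IsSVD.frobNorm_tail_sq {X : Matrix (Fin N) (Fin d) ℝ} {U : Matrix (Fin N) (Fin r) ℝ}
    {σ : Fin r → ℝ} {V : Matrix (Fin d) (Fin r) ℝ} (h : IsSVD X U σ V) :
    frobNorm (U * diagonal (tailVal k σ) * Vᵀ) ^ 2 =
      ∑ j : Fin r, (if (j : ℕ) < k then 0 else σ j ^ 2) := by
  have h1 : U * diagonal (tailVal k σ) * Vᵀ * (U * diagonal (tailVal k σ) * Vᵀ)ᵀ =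
      U * (diagonal (tailVal k σ) * (Vᵀ * V) * diagonal (tailVal k σ) * Uᵀ) := by
    simp [Matrix.transpose_mul, Matrix.mul_assoc]
  rw [frobNorm_sq_eq_trace, h1, h.right_orthonormal, Matrix.mul_one, Matrix.trace_mul_comm,
    Matrix.mul_assoc, h.left_orthonormal, Matrix.mul_one, Matrix.diagonal_mul_diagonal,
    Matrix.trace_diagonal]
  refine Finset.sum_congr rfl fun j _ => ?_
  unfold tailVal
  split_ifs <;> ring

/-- For each `S` of positive probability, some matrix in the span of the columns `X_{:,S}` has an
error governed by the tangents of the angles between the selected coordinates and `V_k`. -/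
lemma IsSVD.exists_colSpan_error {X : Matrix (Fin N) (Fin d) ℝ} {U : Matrix (Fin N) (Fin r) ℝ}
    {σ : Fin r → ℝ} {V : Matrix (Fin d) (Fin r) ℝ} (h : IsSVD X U σ V) (hk : k ≤ r)
    {S : Finset (Fin d)} (hS : S.card = k) (hq : gramMinor (firstCols V k hk) S ≠ 0) :
    ∃ A ∈ colSpanRankLE X S k, ∃ t : ℝ,
      gramMinor (firstCols V k hk) S * t =
        ∑ s ∈ S, ∑ j ∈ Sᶜ, gramMinor (firstCols V k hk) (insert j (S.erase s)) ∧
      specNorm (X - A) ^ 2 ≤ singVal σ k ^ 2 + singVal σ k ^ 2 * t ∧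
      frobNorm (X - A) ^ 2 ≤ (∑ j : Fin r, (if (j : ℕ) < k then 0 else σ j ^ 2)) +
        singVal σ k ^ 2 * t := by
  set W := firstCols V k hk with hWdef
  have hW : Wᵀ * W = 1 := firstCols_transpose_mul_self h.right_orthonormal hk
  obtain ⟨B, hB1, hB2, hB3⟩ := exists_oblique_factor hW hS hq
  let E : Matrix (Fin d) {i // i ∈ S} ℝ :=
    (1 : Matrix (Fin d) (Fin d) ℝ).submatrix id (fun i => (i : Fin d))
  have hME : ∀ {m : ℕ} (M : Matrix (Fin m) (Fin d) ℝ),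
      M * E = M.submatrix id (fun i : {i // i ∈ S} => (i : Fin d)) := by
    intro m M
    have : M * E = (M * (1 : Matrix (Fin d) (Fin d) ℝ)).submatrix id (fun i : {i // i ∈ S} => (i : Fin d)) := rfl
    rw [this, Matrix.mul_one]
  let P := E * B
  have hP1 : Wᵀ * P = Wᵀ := by
    rw [← Matrix.mul_assoc, hME]; exact hB1
  have hP2 : P * (W * Wᵀ) = P := by rw [Matrix.mul_assoc, hB2]
  have hEE : Eᵀ * E = 1 := by
    have : Eᵀ * E = ((1 : Matrix (Fin d) (Fin d) ℝ)ᵀ * 1).submatrix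
      (fun i : {i // i ∈ S} => (i : Fin d)) (fun i : {i // i ∈ S} => (i : Fin d)) := rfl
    rw [this, Matrix.transpose_one, Matrix.one_mul,
      Matrix.submatrix_one _ Subtype.val_injective]
  have hPn : frobNorm P ^ 2 = ∑ s, ∑ j, B s j ^ 2 := by
    rw [frobNorm_sq_eq_trace, sum_sq_eq_trace, Matrix.trace_mul_comm]
    have : Pᵀ * P = Bᵀ * (Eᵀ * E) * B := by simp [P, Matrix.transpose_mul, Matrix.mul_assoc]
    rw [this, hEE, Matrix.mul_one, Matrix.trace_mul_comm]
  set Y := U * diagonal (tailVal k σ) * Vᵀ with hYdef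
  have hXY : X - X * (W * Wᵀ) = Y := h.sub_mul_firstCols hk
  have hYW : Y * W = 0 := by
    rw [← hXY, Matrix.sub_mul, Matrix.mul_assoc X, Matrix.mul_assoc W, hW, Matrix.mul_one,
      sub_self]
  have hres : X - X * P = Y - Y * P := by
    rw [← hXY, Matrix.sub_mul, Matrix.mul_assoc X _ P, Matrix.mul_assoc W Wᵀ P, hP1]
    abel
  -- `Y` does not see the part of `P` in the column space of `W`. Discarding it removes exactly the
  -- `k` coming from the terms `j ∈ S` of Cramer's rule.
  set Q := (1 - W * Wᵀ) * P with hQ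
  have hYQ : Y * P = Y * Q := by
    rw [hQ, Matrix.sub_mul, Matrix.one_mul, Matrix.mul_sub, Matrix.mul_assoc W,
      ← Matrix.mul_assoc Y W, hYW, Matrix.zero_mul, sub_zero]
  have hmain := residual_mul_transpose hYW hP2
  rw [← hres, hYQ] at hmain
  have hYs : specNorm Y ^ 2 ≤ singVal σ k ^ 2 :=
    pow_le_pow_left₀ (specNorm_nonneg _) h.specNorm_tail_le 2
  refine ⟨X * P, ⟨B, ?_, ?_⟩, frobNorm Q ^ 2, ?_, ?_, ?_⟩
  · refine (Matrix.rank_le_card_height B).trans ?_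
    simp [hS]
  · rw [← Matrix.mul_assoc, hME]; rfl
  · rw [frobNorm_sq_tangent hW hP1, hPn, mul_sub, hB3]; ring
  · rw [← specNorm_mul_transpose_self, hmain]
    refine (specNorm_add_le _ _).trans ?_
    rw [specNorm_mul_transpose_self, specNorm_mul_transpose_self]
    refine add_le_add hYs ?_
    calc specNorm (Y * Q) ^ 2 ≤ (specNorm Y * frobNorm Q) ^ 2 := by
          refine pow_le_pow_left₀ (specNorm_nonneg _) ((specNorm_mul_le _ _).trans ?_) 2
          exact mul_le_mul_of_nonneg_left (specNorm_le_frobNorm Q) (specNorm_nonneg _)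
      _ = specNorm Y ^ 2 * frobNorm Q ^ 2 := mul_pow _ _ _
      _ ≤ _ := mul_le_mul_of_nonneg_right hYs (sq_nonneg _)
  · rw [frobNorm_sq_eq_trace, hmain, Matrix.trace_add, ← frobNorm_sq_eq_trace,
      ← frobNorm_sq_eq_trace, h.frobNorm_tail_sq]
    gcongr
    exact (frobNorm_mul_sq_le _ _).trans (mul_le_mul_of_nonneg_right hYs (sq_nonneg _))

end Oblique

/-! ### Expected errors -/

section Expectation

variable {d k : ℕ} {W : Matrix (Fin d) (Fin k) ℝ} {μ : PMF (Finset (Fin d))}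

/-- Common to both norms: weighting by `q(S)` clears the denominator of `t`, and the exchange bound
finishes. Only sets with nonzero minor need a bound, as the others have no mass. -/
lemma IsDPP.expectation_le (hW : Wᵀ * W = 1) (hμ : IsDPP (W * Wᵀ) μ) {F : Finset (Fin d) → ℝ}
    {a b : ℝ} (hb : 0 ≤ b)
    (hF : ∀ S : Finset (Fin d), S.card = k → gramMinor W S ≠ 0 → ∃ t : ℝ,
      gramMinor W S * t = ∑ s ∈ S, ∑ j ∈ Sᶜ, gramMinor W (insert j (S.erase s)) ∧
      F S ≤ a + b * t) :
    expectation μ F ≤ a + b * ((k : ℝ) * ((sparsity W : ℝ) - k)) := by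
  have hsum : ∀ G : Finset (Fin d) → ℝ, ∑ S, (μ S).toReal * G S =
      ∑ S with S.card = k ∧ gramMinor W S ≠ 0, gramMinor W S * G S := by
    intro G
    rw [Finset.sum_filter]
    refine Finset.sum_congr rfl fun S _ => ?_
    split_ifs with hS
    · rw [hμ.eq_gramMinor hS.1]
    · by_cases hc : S.card = k
      · rw [hμ.eq_gramMinor hc, not_not.1 fun hne => hS ⟨hc, hne⟩, zero_mul]
      · rw [hμ.eq_zero_of_card_ne hW hc, zero_mul]
  have hone : ∑ S with S.card = k ∧ gramMinor W S ≠ 0, gramMinor W S = 1 := by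
    have := hsum fun _ => 1
    simp only [mul_one] at this
    rw [← this, sum_pmf_toReal]
  have hex := sum_exchange_le W
  rw [← Finset.sum_mul, hone, one_mul] at hex
  rw [expectation, hsum]
  calc ∑ S with S.card = k ∧ gramMinor W S ≠ 0, gramMinor W S * F S
      ≤ ∑ S with S.card = k ∧ gramMinor W S ≠ 0, (gramMinor W S * a +
          b * ∑ s ∈ S, ∑ j ∈ Sᶜ, gramMinor W (insert j (S.erase s))) := by
        refine Finset.sum_le_sum fun S hS => ?_
        obtain ⟨hc, hq⟩ := (Finset.mem_filter.1 hS).2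
        obtain ⟨t, ht, hle⟩ := hF S hc hq
        rw [← ht]
        have := mul_le_mul_of_nonneg_left hle (gramMinor_nonneg W hc)
        linarith
    _ = a + b * ∑ S with S.card = k ∧ gramMinor W S ≠ 0,
          ∑ s ∈ S, ∑ j ∈ Sᶜ, gramMinor W (insert j (S.erase s)) := by
        rw [Finset.sum_add_distrib, ← Finset.sum_mul, hone, one_mul, ← Finset.mul_sum]
    _ ≤ _ := by gcongr

lemma IsDPP.le_sparsity (hW : Wᵀ * W = 1) (hμ : IsDPP (W * Wᵀ) μ) : k ≤ sparsity W := by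
  obtain ⟨S, hS⟩ := μ.support_nonempty
  have hne : (μ S).toReal ≠ 0 :=
    (ENNReal.toReal_pos ((μ.mem_support_iff S).1 hS) (μ.apply_ne_top S)).ne'
  have hc : S.card = k := by
    by_contra hc; exact hne (hμ.eq_zero_of_card_ne hW hc)
  rw [hμ.eq_gramMinor hc] at hne
  refine hc.symm.le.trans ?_
  rw [← Set.ncard_coe_finset, sparsity]
  exact Set.ncard_le_ncard
    (fun i hi => leverageScore_ne_zero_of_gramMinor_ne_zero W hne (Finset.mem_coe.1 hi))
    (Set.toFinite _)

end Expectation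

/-! ### The flatness parameter and the final bounds -/

lemma sum_Ico_singVal_sq {d r k : ℕ} (hrd : r ≤ d) (σ : Fin r → ℝ) :
    ∑ j ∈ Finset.Ico k d, singVal σ j ^ 2 =
      ∑ j : Fin r, (if (j : ℕ) < k then 0 else σ j ^ 2) := by
  have h1 : ∑ j : Fin r, (if (j : ℕ) < k then 0 else σ j ^ 2) =
      ∑ j ∈ Finset.range r, if j < k then 0 else singVal σ j ^ 2 := by
    rw [Finset.sum_range]
    refine Finset.sum_congr rfl fun j _ => ?_
    rw [singVal_of_lt σ j.2]
  have h2 : ∑ j ∈ Finset.range r, (if j < k then 0 else singVal σ j ^ 2) =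
      ∑ j ∈ Finset.range d, if j < k then 0 else singVal σ j ^ 2 := by
    refine Finset.sum_subset (Finset.range_mono hrd) fun j _ hj => ?_
    rw [singVal_of_ge σ (by simpa using hj)]; simp
  rw [h1, h2]
  have h3 : Finset.Ico k d = (Finset.range d).filter fun j => ¬ j < k := by
    ext j; simp only [Finset.mem_Ico, Finset.mem_filter, Finset.mem_range]; omega
  rw [h3, Finset.sum_filter]
  exact Finset.sum_congr rfl fun j _ => by split_ifs <;> rfl

/-- The flatness is normalized so that multiplying by the tail energy returns `(d - k) σ_{k+1}²`.
For `k = r` both sides vanish because `σ_{k+1} = 0`, whatever the zero denominators. -/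
lemma IsSVD.flatness_mul {N d r k : ℕ} {X : Matrix (Fin N) (Fin d) ℝ}
    {U : Matrix (Fin N) (Fin r) ℝ} {σ : Fin r → ℝ} {V : Matrix (Fin d) (Fin r) ℝ}
    (h : IsSVD X U σ V) (hk : k ≤ r) (p : ℝ) :
    flatness d k σ * (p / ((d : ℝ) - k)) *
      (∑ j : Fin r, (if (j : ℕ) < k then 0 else σ j ^ 2)) = singVal σ k ^ 2 * p := by
  rw [flatness, sum_Ico_singVal_sq h.rank_le]
  rcases hk.eq_or_lt with rfl | hkr
  · simp [singVal_of_ge σ le_rfl]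
  · have hd : (0 : ℝ) < (d : ℝ) - k := sub_pos.2 (by exact_mod_cast hkr.trans_le h.rank_le)
    have hpos : 0 < ∑ j : Fin r, (if (j : ℕ) < k then 0 else σ j ^ 2) := by
      refine Finset.sum_pos' (fun j _ => by split_ifs <;> positivity) ⟨⟨k, hkr⟩, by simp, ?_⟩
      have := h.pos ⟨k, hkr⟩
      simp only [lt_irrefl, if_false]
      positivity
    field_simp

theorem mainTheorem2 {N d r k : ℕ} (hk : k ≤ r)
    (X : Matrix (Fin N) (Fin d) ℝ) (U : Matrix (Fin N) (Fin r) ℝ) (σ : Fin r → ℝ)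
    (V : Matrix (Fin d) (Fin r) ℝ) (hX : IsSVD X U σ V)
    -- the law of the random subset `S`: the projection DPP of marginal kernel `V_k V_kᵀ`
    (μ : PMF (Finset (Fin d)))
    (hμ : IsDPP (firstCols V k hk * (firstCols V k hk).transpose) μ)
    -- `Π_S^2 X`, `Π_S^Fr X` for `|S| = k`
    (PS₂ PSF : Finset (Fin d) → Matrix (Fin N) (Fin d) ℝ)
    (hPS₂ : ∀ S : Finset (Fin d), S.card = k →
      IsBestApprox specNorm X (colSpanRankLE X S k) (PS₂ S))
    (hPSF : ∀ S : Finset (Fin d), S.card = k →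
      IsBestApprox frobNorm X (colSpanRankLE X S k) (PSF S))
    -- `Π_k X`, in the spectral and in the Frobenius sense
    (Pk₂ PkF : Matrix (Fin N) (Fin d) ℝ)
    (hPk₂ : IsBestApprox specNorm X (rankLE N d k) Pk₂)
    (hPkF : IsBestApprox frobNorm X (rankLE N d k) PkF) :
    expectation μ (fun S => specNorm (X - PS₂ S) ^ 2) ≤
        (1 + (k : ℝ) * ((sparsity (firstCols V k hk) : ℝ) - (k : ℝ))) *
          specNorm (X - Pk₂) ^ 2 ∧
      expectation μ (fun S => frobNorm (X - PSF S) ^ 2) ≤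
        (1 + flatness d k σ * (((sparsity (firstCols V k hk) : ℝ) - (k : ℝ)) /
            ((d : ℝ) - (k : ℝ))) * (k : ℝ)) *
          frobNorm (X - PkF) ^ 2 := by
  have hW := firstCols_transpose_mul_self hX.right_orthonormal hk
  have hp : (0 : ℝ) ≤ (sparsity (firstCols V k hk) : ℝ) - k :=
    sub_nonneg.2 (by exact_mod_cast hμ.le_sparsity hW)
  have hkp : (0 : ℝ) ≤ (k : ℝ) * ((sparsity (firstCols V k hk) : ℝ) - k) :=
    mul_nonneg (Nat.cast_nonneg k) hp
  constructor
  · refine (hμ.expectation_le hW (sq_nonneg (singVal σ k)) (a := singVal σ k ^ 2)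
      fun S hS hq => ?_).trans ?_
    · obtain ⟨A, hA, t, ht, hspec, -⟩ := hX.exists_colSpan_error hk hS hq
      -- Minimality of `Π_S^2 X` is used only against the oblique candidate `A`.
      exact ⟨t, ht, (pow_le_pow_left₀ (specNorm_nonneg _) ((hPS₂ S hS).2 A hA) 2).trans hspec⟩
    · have h1 := pow_le_pow_left₀ (hX.singVal_nonneg k) (hX.singVal_le_of_rank_le Pk₂ hPk₂.1) 2
      have h2 := mul_le_mul_of_nonneg_left h1 (add_nonneg zero_le_one hkp)
      linarith
  · refine (hμ.expectation_le hW (sq_nonneg (singVal σ k))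
      (a := ∑ j : Fin r, (if (j : ℕ) < k then 0 else σ j ^ 2)) fun S hS hq => ?_).trans ?_
    · obtain ⟨A, hA, t, ht, -, hfrob⟩ := hX.exists_colSpan_error hk hS hq
      exact ⟨t, ht, (pow_le_pow_left₀ (frobNorm_nonneg _) ((hPSF S hS).2 A hA) 2).trans hfrob⟩
    · have h1 := hX.sum_sq_le_of_rank_le hk PkF hPkF.1
      have hd : (0 : ℝ) ≤ (d : ℝ) - k := sub_nonneg.2 (by exact_mod_cast hk.trans hX.rank_le)
      have hβ : 0 ≤ flatness d k σ := by
        unfold flatness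
        positivity
      have h2 := mul_le_mul_of_nonneg_left h1 (add_nonneg zero_le_one
        (mul_nonneg (mul_nonneg hβ (div_nonneg hp hd)) (Nat.cast_nonneg k)))
      have h3 := hX.flatness_mul hk ((sparsity (firstCols V k hk) : ℝ) - k)
      refine le_trans (le_of_eq ?_) h2
      linear_combination (-(k : ℝ)) * h3
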